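/- A sender privately observes a state of nature $\theta\in\{H,L\}$, where $\Pr(\theta=H)=p\in(0,1)$. Conditional on $\theta$, signals are i.i.d. on a finite set $S$ with distribution $\pi_\theta$, where $\pi_\theta(s)>0$ for all $\theta,s$ and $\pi_H\neq\pi_L$. A protocol of the receiver with $m$ memory states, $M=\{1,\dots,m\}$, is a triple $\Pi=(f,g,a)$ consisting of a transition function $f:M\times S\to\Delta(M)$, an initial distribution $g\in\Delta(M)$ and an action rule $a:M\to[0,1]$. Knowing $\Pi$, the sender chooses a strategy $\sigma:M\times\{H,L\}\to[0,1]$. The initial memory state $m_0$ is drawn from $g$. In each period $t=0,1,2,\dots$ the game ends if the current memory state $m_t$ is absorbing, i.e. $f(m_t,s)(m_t)=1$ for all $s\in S$; otherwise the sender stops with probability $\sigma(m_t,\theta)$, which also ends the game, and if she does not stop, a signal $s_t\sim\pi_\theta$ is generated and $m_{t+1}$ is drawn from $f(m_t,s_t)$. When the game ends in memory state $i$, the receiver takes action $H$ with probability $a(i)$ and action $L$ otherwise. The sender gets $1$ if the action is $H$ and $0$ if it is $L$; the receiver gets $1$ if the action equals $\theta$ and $0$ otherwise; both get $0$ if the game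 never ends. Let $U^S(\Pi,\sigma)$ and $U^R(\Pi,\sigma)$ be the expected payoffs and let $\mathrm{br}(\Pi)=\arg\max_\sigma U^S(\Pi,\sigma)$. The receiver's payoff $U^R(\Pi)$ from $\Pi$ is $U^R(\Pi,\sigma)$ with $\sigma\in\mathrm{br}(\Pi)$. A protocol is called parsimonious if it has two absorbing memory states, one where $L$ is played with probability $1$ and one where $H$ is played with probability $1$, and every other memory state is transient (for the Markov chain on $M$ induced by $f$ and $\pi_\theta$ when signals keep being generated, for each $\theta$), with $L$ played there with probability $1$. **Theorem.** Let $m\ge 2$ and let $\Pi$ be a protocol with $m$ memory states that is not parsimonious. Then there is a parsimonious protocol $\Pi'$ with at most $m$ memory states such that $U^R(\Pi)\le U^R(\Pi')$. That is, $\mathrm{br}(\Pi)$ and $\mathrm{br}(\Pi')$ are nonempty, and $U^R(\Pi,\sigma)\le U^R(\Pi',\sigma')$ for all $\sigma\in\mathrm{br}(\Pi)$ and $\sigma'\in\mathrm{br}(\Pi')$. -/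

import Mathlib

/-- The two states of nature; the receiver's actions carry the same names. -/
inductive Nature : Type
  | H : Nature
  | L : Nature

/-- The exogenous data of the game: the prior probability `p` of the state `H`, and the signal
distributions `signal θ` on the finite set `S`, which have full support and differ in the two
states of nature. -/
structure Environment (S : Type*) [Fintype S] where
  p : ℝ
  p_pos : 0 < p
  p_lt_one : p < 1
  signal : Nature → S → ℝ
  signal_pos : ∀ θ s, 0 < signal θ s
  signal_sum : ∀ θ, ∑ s, signal θ s = 1
  signal_ne : signal Nature.H ≠ signal Nature.L

/-- A protocol with `m` memory states: transition function `f`, initial distribution `g`,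
and action rule `a`, where `a i` is the probability of taking action `H` in memory state `i`. -/
structure Protocol (m : ℕ) (S : Type*) where
  f : Fin m → S → stdSimplex ℝ (Fin m)
  g : stdSimplex ℝ (Fin m)
  a : Fin m → unitInterval

/-- A strategy of the sender: the probability of stopping the signal process, as a function of the
current memory state and of the state of nature. -/
abbrev SenderStrategy (m : ℕ) : Type := Fin m → Nature → unitInterval

namespace Protocol

variable {S : Type*} [Fintype S] {m : ℕ}

/-- The memory state `i` is not updated in response to any signal. -/
def IsAbsorbing (P : Protocol m S) (i : Fin m) : Prop :=
  ∀ s : S, P.f i s i = 1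

/-- The one-step transition probabilities of the Markov chain on memory states that the protocol
induces in the state of nature `θ` when signals keep being generated. -/
def trans (E : Environment S) (P : Protocol m S) (θ : Nature) (i j : Fin m) : ℝ :=
  ∑ s, E.signal θ s * P.f i s j

/-- The probability that the induced chain, started in `j`, visits `i` at some time in
`{1, …, n}`. -/
def hitWithin (E : Environment S) (P : Protocol m S) (θ : Nature) (i : Fin m) : ℕ → Fin m → ℝ
  | 0, _ => 0
  | n + 1, j =>
      P.trans E θ j i + ∑ k ∈ Finset.univ.erase i, P.trans E θ j k * P.hitWithin E θ i n k

/-- The probability that the induced chain, started in `i`, ever returns to `i`. -/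
noncomputable def returnProb (E : Environment S) (P : Protocol m S) (θ : Nature) (i : Fin m) : ℝ :=
  ⨆ n : ℕ, P.hitWithin E θ i n i

/-- The memory state `i` is transient in the state of nature `θ`. -/
def IsTransient (E : Environment S) (P : Protocol m S) (θ : Nature) (i : Fin m) : Prop :=
  P.returnProb E θ i < 1

/-- There are two absorbing memory states, one where `L` and one where `H` is played with
probability one; all other memory states are transient, with `L` played with probability one. -/
def IsParsimonious (E : Environment S) (P : Protocol m S) : Prop :=
  ∃ iL iH : Fin m, iL ≠ iH ∧
    P.IsAbsorbing iL ∧ (P.a iL : ℝ) = 0 ∧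
    P.IsAbsorbing iH ∧ (P.a iH : ℝ) = 1 ∧
    ∀ j : Fin m, j ≠ iL → j ≠ iH → (∀ θ, P.IsTransient E θ j) ∧ (P.a j : ℝ) = 0

open Classical in
/-- The probability that the game ends in the current period if it is still going on and the
current memory state is `i`: it ends for sure in an absorbing memory state, and otherwise exactly
if the sender stops. -/
noncomputable def endRate (P : Protocol m S) (σ : SenderStrategy m) (θ : Nature) (i : Fin m) : ℝ :=
  if P.IsAbsorbing i then 1 else (σ i θ : ℝ)

/-- The probability, given `θ`, that the game has not ended before period `t` and that the memory
state in period `t` is `i`. -/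
noncomputable def alive (E : Environment S) (P : Protocol m S) (σ : SenderStrategy m) (θ : Nature) :
    ℕ → Fin m → ℝ
  | 0, i => P.g i
  | t + 1, j => ∑ i, P.alive E σ θ t i * (1 - P.endRate σ θ i) * P.trans E θ i j

/-- The probability, given `θ`, that the game ends in period `t` in the memory state `i`. -/
noncomputable def endAt (E : Environment S) (P : Protocol m S) (σ : SenderStrategy m) (θ : Nature)
    (t : ℕ) (i : Fin m) : ℝ :=
  P.alive E σ θ t i * P.endRate σ θ i

/-- The probability, given `θ`, that the game ever ends and does so in the memory state `i`. -/
noncomputable def endProb (E : Environment S) (P : Protocol m S) (σ : SenderStrategy m)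
    (θ : Nature) (i : Fin m) : ℝ :=
  ∑' t : ℕ, P.endAt E σ θ t i

/-- The probability, given `θ`, that the game ends and action `H` is taken. -/
noncomputable def probH (E : Environment S) (P : Protocol m S) (σ : SenderStrategy m)
    (θ : Nature) : ℝ :=
  ∑ i, P.endProb E σ θ i * (P.a i : ℝ)

/-- The probability, given `θ`, that the game ends and action `L` is taken. -/
noncomputable def probL (E : Environment S) (P : Protocol m S) (σ : SenderStrategy m)
    (θ : Nature) : ℝ :=
  ∑ i, P.endProb E σ θ i * (1 - (P.a i : ℝ))

/-- The sender's expected payoff: she gets `1` if action `H` is taken, and `0` if action `L` is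
taken or if the game never ends. -/
noncomputable def senderPayoff (E : Environment S) (P : Protocol m S) (σ : SenderStrategy m) : ℝ :=
  E.p * P.probH E σ Nature.H + (1 - E.p) * P.probH E σ Nature.L

/-- The receiver's expected payoff: he gets `1` if the action taken matches the state of nature,
and `0` if it does not or if the game never ends. -/
noncomputable def receiverPayoff (E : Environment S) (P : Protocol m S) (σ : SenderStrategy m) :
    ℝ :=
  E.p * P.probH E σ Nature.H + (1 - E.p) * P.probL E σ Nature.L

/-- The set of the sender's best responses to a protocol. -/
def bestResponses (E : Environment S) (P : Protocol m S) : Set (SenderStrategy m) :=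
  {σ | ∀ τ : SenderStrategy m, P.senderPayoff E τ ≤ P.senderPayoff E σ}

/-! The remaining facts show that the supremum and the series used above are those of bounded and
of summable families. -/

theorem trans_nonneg (E : Environment S) (P : Protocol m S) (θ : Nature) (i j : Fin m) :
    0 ≤ P.trans E θ i j :=
  Finset.sum_nonneg fun s _ => mul_nonneg (E.signal_pos θ s).le ((P.f i s).2.1 j)

theorem trans_sum (E : Environment S) (P : Protocol m S) (θ : Nature) (i : Fin m) :
    ∑ j, P.trans E θ i j = 1 := by
  unfold trans
  rw [Finset.sum_comm]
  have h : ∀ s, ∑ j, E.signal θ s * P.f i s j = E.signal θ s := fun s => by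
    rw [← Finset.mul_sum, show ∑ j, P.f i s j = 1 from (P.f i s).2.2, mul_one]
  simp only [h, E.signal_sum]

theorem hitWithin_mem (E : Environment S) (P : Protocol m S) (θ : Nature) (i : Fin m) (n : ℕ) :
    ∀ j, 0 ≤ P.hitWithin E θ i n j ∧ P.hitWithin E θ i n j ≤ 1 := by
  induction n with
  | zero => intro j; simp [hitWithin]
  | succ n ih =>
    intro j
    have h0 := P.trans_nonneg E θ
    refine ⟨add_nonneg (h0 _ _) (Finset.sum_nonneg fun k _ => mul_nonneg (h0 _ _) (ih k).1), ?_⟩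
    rw [← P.trans_sum E θ j, ← Finset.add_sum_erase _ _ (Finset.mem_univ i)]
    exact add_le_add le_rfl
      (Finset.sum_le_sum fun k _ => mul_le_of_le_one_right (h0 _ _) (ih k).2)

theorem bddAbove_hitWithin (E : Environment S) (P : Protocol m S) (θ : Nature) (i : Fin m) :
    BddAbove (Set.range fun n : ℕ => P.hitWithin E θ i n i) :=
  ⟨1, by rintro _ ⟨n, rfl⟩; exact (P.hitWithin_mem E θ i n i).2⟩

set_option linter.unusedSectionVars false in
theorem endRate_mem (P : Protocol m S) (σ : SenderStrategy m) (θ : Nature) (i : Fin m) :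
    0 ≤ P.endRate σ θ i ∧ P.endRate σ θ i ≤ 1 := by
  unfold endRate
  split_ifs
  · norm_num
  · exact (σ i θ).2

theorem alive_nonneg (E : Environment S) (P : Protocol m S) (σ : SenderStrategy m) (θ : Nature)
    (t : ℕ) : ∀ i, 0 ≤ P.alive E σ θ t i := by
  induction t with
  | zero => exact fun i => P.g.2.1 i
  | succ t ih =>
    exact fun j => Finset.sum_nonneg fun i _ => mul_nonneg
      (mul_nonneg (ih i) (sub_nonneg.2 (P.endRate_mem σ θ i).2)) (P.trans_nonneg E θ i j)

theorem endAt_nonneg (E : Environment S) (P : Protocol m S) (σ : SenderStrategy m) (θ : Nature)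
    (t : ℕ) (i : Fin m) : 0 ≤ P.endAt E σ θ t i :=
  mul_nonneg (P.alive_nonneg E σ θ t i) (P.endRate_mem σ θ i).1

theorem alive_add_ended (E : Environment S) (P : Protocol m S) (σ : SenderStrategy m) (θ : Nature)
    (t : ℕ) :
    ∑ i, P.alive E σ θ t i + ∑ r ∈ Finset.range t, ∑ i, P.endAt E σ θ r i = 1 := by
  induction t with
  | zero =>
    rw [Finset.range_zero, Finset.sum_empty, add_zero]
    exact P.g.2.2
  | succ t ih =>
    have h : ∑ j, P.alive E σ θ (t + 1) j
        = ∑ i, P.alive E σ θ t i - ∑ i, P.endAt E σ θ t i := by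
      simp only [alive, endAt]
      rw [Finset.sum_comm, ← Finset.sum_sub_distrib]
      refine Finset.sum_congr rfl fun i _ => ?_
      rw [← Finset.mul_sum, P.trans_sum]
      ring
    rw [Finset.sum_range_succ, h]
    linarith

theorem summable_endAt (E : Environment S) (P : Protocol m S) (σ : SenderStrategy m) (θ : Nature)
    (i : Fin m) : Summable fun t : ℕ => P.endAt E σ θ t i := by
  refine summable_of_sum_range_le (c := 1) (fun t => P.endAt_nonneg E σ θ t i) fun n => ?_
  have h1 : ∑ t ∈ Finset.range n, P.endAt E σ θ t i
      ≤ ∑ t ∈ Finset.range n, ∑ k, P.endAt E σ θ t k :=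
    Finset.sum_le_sum fun t _ =>
      Finset.single_le_sum (fun k _ => P.endAt_nonneg E σ θ t k) (Finset.mem_univ i)
  have h2 := P.alive_add_ended E σ θ n
  have h3 : 0 ≤ ∑ k, P.alive E σ θ n k :=
    Finset.sum_nonneg fun k _ => P.alive_nonneg E σ θ n k
  linarith

end Protocol

/-! In each state of nature the sender faces a finite optimal stopping problem with reward `a`.
Since both states have positive prior probability, a best response attains the optimal value in each
of them separately (`probH_of_mem_bestResponses`), so payoff comparisons can be made state by state.

Let `D` be the set where stopping is optimal in state `H`, and let `τ` stop exactly on `D` in both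
states. Replacing a best response by `τ` leaves the probability of action `H` in state `H` unchanged
and cannot raise it in state `L`, where `τ` is merely feasible. Full support of the signals makes
`D` reachable in state `L` as well, so `τ` ends the game almost surely. Hence the receiver's payoff
is at most what he would get if the sender played `τ`, and this is at most what he would get by
choosing the better action at each memory state where `τ` stops.

That bound is attained by a parsimonious protocol (`exists_parsimonious`). Let `A` be the states of
`D` at which `H` is strictly better for the receiver. Follow the original protocol outside `D`, send
`A` to an absorbing `H` state and the rest of `D` to an absorbing `L` state. Stopping early now
yields `L`, so the sender gains nothing from it, and the outcome distribution is that of `τ` with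
improved actions. The absorbing states are taken from `A` and from `D \ A`, so no memory is added;
if one of these sets is empty, a protocol that starts in an absorbing state does the job. -/

open Filter Topology

/-! ### Excessive majorants and drift functions of finite kernels -/

/-- From every nonempty set of states disjoint from `D`, the kernel `T` can leave the set. -/
def CanReach {ι : Type*} (T : ι → ι → ℝ) (D : Finset ι) : Prop :=
  ∀ K : Finset ι, K.Nonempty → Disjoint K D → ∃ i ∈ K, ∃ j ∉ K, 0 < T i j

/-- An excessive majorant `v` of the reward `a` that cannot be lowered: every nonempty set of
states contains one where `v` equals the reward, or one where `v` is harmonic and from which the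
set can be left. -/
theorem exists_minimal_excessive {ι : Type*} [Fintype ι] [DecidableEq ι] (T : ι → ι → ℝ)
    (hT : ∀ i j, 0 ≤ T i j) (hT1 : ∀ i, ∑ j, T i j = 1) (a : ι → ℝ) (ha0 : ∀ i, 0 ≤ a i)
    (ha1 : ∀ i, a i ≤ 1) :
    ∃ v : ι → ℝ, (∀ i, a i ≤ v i) ∧ (∀ i, ∑ j, T i j * v j ≤ v i) ∧
      ∀ K : Finset ι, K.Nonempty →
        ∃ i ∈ K, v i = a i ∨ (v i = ∑ j, T i j * v j ∧ ∃ j ∉ K, 0 < T i j) := by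
  let C : Set (ι → ℝ) :=
    Set.Icc 0 1 ∩ ⋂ i, ({v | a i ≤ v i} ∩ {v | ∑ j, T i j * v j ≤ v i})
  have hC : IsCompact C := by
    refine isCompact_Icc.inter_right (isClosed_iInter fun i => ?_)
    exact (isClosed_le (by fun_prop) (by fun_prop)).inter (isClosed_le (by fun_prop) (by fun_prop))
  have hne : C.Nonempty := by
    refine ⟨1, ⟨zero_le_one, le_rfl⟩, Set.mem_iInter.2 fun i => ⟨ha1 i, ?_⟩⟩
    simp [hT1]
  obtain ⟨v, hv, hmin⟩ := hC.exists_isMinOn hne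
    (f := fun v : ι → ℝ => ∑ i, v i) (by fun_prop)
  obtain ⟨⟨hv0, hv1⟩, hvC⟩ := hv
  rw [Set.mem_iInter] at hvC
  have hva : ∀ i, a i ≤ v i := fun i => (hvC i).1
  have hvT : ∀ i, ∑ j, T i j * v j ≤ v i := fun i => (hvC i).2
  refine ⟨v, hva, hvT, fun K hK => ?_⟩
  by_contra! hcon
  -- The slack available for lowering `v` on all of `K`. At a harmonic state the value 1 is an
  -- arbitrary positive number: no transition from there leaves `K`, so lowering `v` uniformly on
  -- `K` lowers both sides equally.
  let δ : ι → ℝ := fun i =>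
    min (v i - a i) (if v i = ∑ j, T i j * v j then 1 else v i - ∑ j, T i j * v j)
  have hδ : ∀ i ∈ K, 0 < δ i := by
    intro i hi
    refine lt_min (sub_pos.2 (lt_of_le_of_ne (hva i) (hcon i hi).1.symm)) ?_
    split_ifs with h
    · exact one_pos
    · exact sub_pos.2 (lt_of_le_of_ne (hvT i) (Ne.symm h))
  obtain ⟨k, hk, hkmin⟩ := K.exists_min_image δ hK
  have hε := hδ k hk
  set ε := δ k
  let w : ι → ℝ := fun i => if i ∈ K then v i - ε else v i
  have hwv : ∀ i, w i ≤ v i := fun i => by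
    simp only [w]; split_ifs <;> linarith
  have hwa : ∀ i, a i ≤ w i := fun i => by
    simp only [w]
    split_ifs with h
    · have := (hkmin i h).trans (min_le_left _ _)
      linarith
    · exact hva i
  have hTwv : ∀ i, ∑ j, T i j * w j ≤ ∑ j, T i j * v j := fun i =>
    Finset.sum_le_sum fun j _ => mul_le_mul_of_nonneg_left (hwv j) (hT i j)
  have hwT : ∀ i, ∑ j, T i j * w j ≤ w i := by
    intro i
    by_cases hi : i ∈ K
    · have hwi : w i = v i - ε := if_pos hi
      rw [hwi]
      by_cases hh : v i = ∑ j, T i j * v j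
      · have h0 := (hcon i hi).2 hh
        have : ∑ j, T i j * w j = ∑ j, (T i j * v j - T i j * ε) := by
          refine Finset.sum_congr rfl fun j _ => ?_
          by_cases hj : j ∈ K
          · simp only [w, if_pos hj]; ring
          · simp [le_antisymm (h0 j hj) (hT i j)]
        rw [this, Finset.sum_sub_distrib, ← Finset.sum_mul, hT1, one_mul, ← hh]
      · have h1 := (hkmin i hi).trans (min_le_right _ _)
        rw [if_neg hh] at h1
        linarith [hTwv i]
    · have hwi : w i = v i := if_neg hi
      rw [hwi]
      exact (hTwv i).trans (hvT i)
  have hwC : w ∈ C := by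
    refine ⟨⟨fun i => (ha0 i).trans (hwa i), fun i => (hwv i).trans (hv1 i)⟩,
      Set.mem_iInter.2 fun i => ⟨hwa i, hwT i⟩⟩
  have hlt : ∑ i, w i < ∑ i, v i := by
    refine Finset.sum_lt_sum (fun i _ => hwv i) ⟨k, Finset.mem_univ k, ?_⟩
    simp only [w, if_pos hk]; linarith
  exact absurd (hmin hwC) (not_le.2 hlt)

/-- If `D` can be reached from everywhere, then there is a nonnegative function that strictly
decreases in expectation outside `D`. -/
theorem CanReach.exists_drift {ι : Type*} [Fintype ι] [DecidableEq ι] {T : ι → ι → ℝ}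
    (hT : ∀ i j, 0 ≤ T i j) (hT1 : ∀ i, ∑ j, T i j = 1) {D : Finset ι} (hD : CanReach T D) :
    ∃ φ : ι → ℝ, (∀ i, 0 ≤ φ i) ∧ ∀ i ∉ D, ∑ j, T i j * φ j < φ i := by
  -- `R` collects the states already treated and grows from `D` one state at a time; `φ` is below 1
  -- exactly on `R`.
  suffices h : ∀ n : ℕ, ∀ R : Finset ι, Rᶜ.card = n → D ⊆ R → ∀ φ : ι → ℝ,
      (∀ i, 0 ≤ φ i) → (∀ i, φ i ≤ 1) → (∀ i ∈ R, φ i < 1) →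
      (∀ i ∉ R, φ i = 1) → (∀ i ∈ R, i ∉ D → ∑ j, T i j * φ j < φ i) →
      ∃ φ : ι → ℝ, (∀ i, 0 ≤ φ i) ∧ ∀ i ∉ D, ∑ j, T i j * φ j < φ i by
    refine h _ D rfl subset_rfl (fun i => if i ∈ D then 0 else 1) ?_ ?_ ?_ ?_ ?_
    · intro i; split_ifs <;> norm_num
    · intro i; split_ifs <;> norm_num
    · intro i hi; simp [hi]
    · intro i hi; simp [hi]
    · intro i hi hi'; exact absurd hi hi'
  intro n
  induction n with
  | zero =>
    intro R hR _ φ h0 _ _ _ h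
    have hu : R = Finset.univ := by simpa using hR
    exact ⟨φ, h0, fun i hi => h i (hu ▸ Finset.mem_univ i) hi⟩
  | succ n ih =>
    intro R hR hDR φ h0 h1 hlt heq hdr
    have hne : Rᶜ.Nonempty := Finset.card_pos.1 (by omega)
    have hdisj : Disjoint Rᶜ D := (Finset.disjoint_left.2 fun i hi hi' =>
      (Finset.mem_compl.1 hi) (hDR hi'))
    obtain ⟨i, hi, j, hj, hij⟩ := hD _ hne hdisj
    rw [Finset.mem_compl] at hi
    rw [Finset.mem_compl, not_not] at hj
    have hTi : ∑ k, T i k * φ k < 1 := by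
      rw [← hT1 i]
      refine Finset.sum_lt_sum (fun k _ => mul_le_of_le_one_right (hT i k) (h1 k))
        ⟨j, Finset.mem_univ j, ?_⟩
      exact mul_lt_of_lt_one_right hij (hlt j hj)
    have hTi0 : 0 ≤ ∑ k, T i k * φ k :=
      Finset.sum_nonneg fun k _ => mul_nonneg (hT i k) (h0 k)
    -- The midpoint keeps the new value below 1 yet above the expected next value. Lowering `φ` at
    -- `i` only lowers expectations elsewhere, so earlier strict inequalities survive.
    set c := (1 + ∑ k, T i k * φ k) / 2 with hc
    have hle : ∀ k, Function.update φ i c k ≤ φ k := by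
      intro k
      rcases eq_or_ne k i with rfl | hk
      · rw [Function.update_self, heq k hi]; linarith
      · rw [Function.update_of_ne hk]
    have hTle : ∀ l, ∑ k, T l k * Function.update φ i c k ≤ ∑ k, T l k * φ k := fun l =>
      Finset.sum_le_sum fun k _ => mul_le_mul_of_nonneg_left (hle k) (hT l k)
    refine ih (insert i R) ?_ (hDR.trans (Finset.subset_insert i R)) (Function.update φ i c)
      ?_ (fun k => (hle k).trans (h1 k)) ?_ ?_ ?_
    · rw [Finset.compl_insert, Finset.card_erase_of_mem (Finset.mem_compl.2 hi), hR]; rfl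
    · intro k
      rcases eq_or_ne k i with rfl | hk
      · rw [Function.update_self]; linarith
      · rw [Function.update_of_ne hk]; exact h0 k
    · intro k hk
      rcases eq_or_ne k i with rfl | hki
      · rw [Function.update_self]; linarith
      · rw [Function.update_of_ne hki]
        exact hlt k (Finset.mem_of_mem_insert_of_ne hk hki)
    · intro k hk
      rw [Finset.mem_insert, not_or] at hk
      rw [Function.update_of_ne hk.1]
      exact heq k hk.2
    · intro k hk hkD
      refine (hTle k).trans_lt ?_
      rcases eq_or_ne k i with rfl | hki
      · rw [Function.update_self]; linarith
      · rw [Function.update_of_ne hki]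
        exact hdr k (Finset.mem_of_mem_insert_of_ne hk hki) hkD

/-! ### Stopped chains: optional stopping, almost sure ending, transience -/

namespace Protocol

variable {S : Type*} [Fintype S] {m : ℕ} (E : Environment S) (P : Protocol m S)

/-- Full support of the signals: positivity depends on `f` alone. This is what carries reachability
from one state of nature to the other. -/
theorem trans_pos_iff (θ θ' : Nature) (i j : Fin m) :
    0 < P.trans E θ i j ↔ 0 < P.trans E θ' i j := by
  have key : ∀ θ, 0 < P.trans E θ i j ↔ ∃ s, 0 < P.f i s j := by
    intro θ
    have h0 : ∀ s ∈ Finset.univ, 0 ≤ E.signal θ s * P.f i s j := fun s _ =>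
      mul_nonneg (E.signal_pos θ s).le ((P.f i s).2.1 j)
    rw [trans, Finset.sum_pos_iff_of_nonneg h0]
    simp [mul_pos_iff_of_pos_left (E.signal_pos θ _)]
  rw [key, key]

variable {E P}

set_option linter.unusedSectionVars false in
theorem IsAbsorbing.f_eq {i : Fin m} (h : P.IsAbsorbing i) (s : S) (j : Fin m) :
    P.f i s j = if j = i then 1 else 0 := by
  split_ifs with hj
  · rw [hj, h s]
  · have h1 : ∑ k, P.f i s k = 1 := (P.f i s).2.2
    have h0 : ∀ k, 0 ≤ P.f i s k := (P.f i s).2.1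
    rw [← Finset.add_sum_erase _ _ (Finset.mem_univ i), h s, add_eq_left,
      Finset.sum_eq_zero_iff_of_nonneg fun k _ => h0 k] at h1
    exact h1 j (Finset.mem_erase.2 ⟨hj, Finset.mem_univ j⟩)

theorem IsAbsorbing.trans_eq {i : Fin m} (h : P.IsAbsorbing i) (θ : Nature) (j : Fin m) :
    P.trans E θ i j = if j = i then 1 else 0 := by
  simp only [trans, h.f_eq, ← Finset.sum_mul, E.signal_sum, one_mul]

theorem canReach_trans (θ θ' : Nature) {D : Finset (Fin m)} (h : CanReach (P.trans E θ) D) :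
    CanReach (P.trans E θ') D := fun K hK hKD => by
  obtain ⟨i, hi, j, hj, hij⟩ := h K hK hKD
  exact ⟨i, hi, j, hj, (P.trans_pos_iff E θ θ' i j).1 hij⟩

variable (E P)

/-- Dynkin's formula for the chain killed when the game ends; the sum telescopes. -/
theorem sum_alive_drift (σ : SenderStrategy m) (θ : Nature) (u : Fin m → ℝ) (t : ℕ) :
    ∑ r ∈ Finset.range t, ∑ i, P.alive E σ θ r i *
        (u i - (1 - P.endRate σ θ i) * ∑ j, P.trans E θ i j * u j)
      = ∑ i, P.g i * u i - ∑ i, P.alive E σ θ t i * u i := by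
  induction t with
  | zero => simp [alive]
  | succ t ih =>
    have h : ∑ j, P.alive E σ θ (t + 1) j * u j = ∑ i, P.alive E σ θ t i *
        ((1 - P.endRate σ θ i) * ∑ j, P.trans E θ i j * u j) := by
      simp only [alive, Finset.sum_mul]
      rw [Finset.sum_comm]
      refine Finset.sum_congr rfl fun i _ => ?_
      simp only [Finset.mul_sum]
      exact Finset.sum_congr rfl fun j _ => by ring
    rw [Finset.sum_range_succ, ih, h]
    simp only [mul_sub, Finset.sum_sub_distrib]
    ring

theorem tendsto_sum_endAt_mul (σ : SenderStrategy m) (θ : Nature) (u : Fin m → ℝ) :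
    Tendsto (fun t => ∑ r ∈ Finset.range t, ∑ i, P.endAt E σ θ r i * u i) atTop
      (𝓝 (∑ i, P.endProb E σ θ i * u i)) :=
  (hasSum_sum fun i _ => (P.summable_endAt E σ θ i).hasSum.mul_right (u i)).tendsto_sum_nat

theorem endProb_nonneg (σ : SenderStrategy m) (θ : Nature) (i : Fin m) :
    0 ≤ P.endProb E σ θ i :=
  tsum_nonneg fun t => P.endAt_nonneg E σ θ t i

variable {E P}

/-- Optional stopping for a nonnegative excessive function; mass that never stops can only lose
value. -/
theorem sum_endProb_mul_le {θ : Nature} {u : Fin m → ℝ} (hu0 : ∀ i, 0 ≤ u i)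
    (hu : ∀ i, ∑ j, P.trans E θ i j * u j ≤ u i) (σ : SenderStrategy m) :
    ∑ i, P.endProb E σ θ i * u i ≤ ∑ i, P.g i * u i := by
  refine le_of_tendsto' (P.tendsto_sum_endAt_mul E σ θ u) fun t => ?_
  have h1 := P.sum_alive_drift E σ θ u t
  have h2 : 0 ≤ ∑ i, P.alive E σ θ t i * u i :=
    Finset.sum_nonneg fun i _ => mul_nonneg (P.alive_nonneg E σ θ t i) (hu0 i)
  refine le_trans (Finset.sum_le_sum fun r _ => Finset.sum_le_sum fun i _ => ?_)
    (h1.le.trans (sub_le_self _ h2))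
  rw [endAt, mul_assoc]
  refine mul_le_mul_of_nonneg_left ?_ (P.alive_nonneg E σ θ r i)
  have := mul_le_mul_of_nonneg_left (hu i) (sub_nonneg.2 (P.endRate_mem σ θ i).2)
  linarith

theorem sum_endProb_le_one (θ : Nature) (σ : SenderStrategy m) :
    ∑ i, P.endProb E σ θ i ≤ 1 := by
  have h := sum_endProb_mul_le (P := P) (E := E) (θ := θ) (u := fun _ => 1)
    (fun _ => zero_le_one) (by simp [P.trans_sum E θ]) σ
  have hg : ∑ i, P.g i = 1 := P.g.2.2
  simpa [hg] using h

theorem probH_add_probL (θ : Nature) (σ : SenderStrategy m) :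
    P.probH E σ θ + P.probL E σ θ = ∑ i, P.endProb E σ θ i := by
  rw [probH, probL, ← Finset.sum_add_distrib]
  exact Finset.sum_congr rfl fun i _ => by ring

/-- If the sender stops on a set that can be reached from everywhere, the game ends almost
surely. -/
theorem tendsto_alive {θ : Nature} {D : Finset (Fin m)} (hD : CanReach (P.trans E θ) D)
    {σ : SenderStrategy m} (hσ : ∀ i ∈ D, P.endRate σ θ i = 1) (j : Fin m) :
    Tendsto (fun t => P.alive E σ θ t j) atTop (𝓝 0) := by
  obtain ⟨φ, hφ0, hφ⟩ := hD.exists_drift (P.trans_nonneg E θ) (P.trans_sum E θ)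
  have hterm : ∀ r i, 0 ≤ P.alive E σ θ r i *
      ((1 - P.endRate σ θ i) * (φ i - ∑ j, P.trans E θ i j * φ j)) := by
    intro r i
    refine mul_nonneg (P.alive_nonneg E σ θ r i) ?_
    by_cases hi : i ∈ D
    · rw [hσ i hi]; simp
    · exact mul_nonneg (sub_nonneg.2 (P.endRate_mem σ θ i).2) (sub_nonneg.2 (hφ i hi).le)
  -- The total drift of `φ` is bounded by its initial expectation. Outside `D` the drift is strictly
  -- positive, so the mass that continues there is summable over time.
  have hto : ∀ i, Tendsto (fun t => P.alive E σ θ t i * (1 - P.endRate σ θ i)) atTop (𝓝 0) := by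
    intro i
    by_cases hi : i ∈ D
    · simp [hσ i hi]
    · have hs : Summable fun r => P.alive E σ θ r i *
          ((1 - P.endRate σ θ i) * (φ i - ∑ j, P.trans E θ i j * φ j)) := by
        refine summable_of_sum_range_le (c := ∑ i, P.g i * φ i) (fun r => hterm r i) fun t => ?_
        have h2 : 0 ≤ ∑ i, P.alive E σ θ t i * φ i :=
          Finset.sum_nonneg fun i _ => mul_nonneg (P.alive_nonneg E σ θ t i) (hφ0 i)
        refine le_trans (Finset.sum_le_sum fun r _ => ?_)
          ((P.sum_alive_drift E σ θ φ t).le.trans (sub_le_self _ h2))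
        refine (Finset.single_le_sum (fun k _ => hterm r k) (Finset.mem_univ i)).trans
          (Finset.sum_le_sum fun k _ =>
            mul_le_mul_of_nonneg_left ?_ (P.alive_nonneg E σ θ r k))
        nlinarith [mul_nonneg (P.endRate_mem σ θ k).1 (hφ0 k)]
      have hd : φ i - ∑ j, P.trans E θ i j * φ j ≠ 0 := (sub_pos.2 (hφ i hi)).ne'
      have h := hs.tendsto_atTop_zero.div_const (φ i - ∑ j, P.trans E θ i j * φ j)
      rw [zero_div] at h
      refine h.congr fun r => ?_
      rw [← mul_assoc, mul_div_cancel_right₀ _ hd]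
  rw [← tendsto_add_atTop_iff_nat 1]
  have h := tendsto_finsetSum Finset.univ fun i _ => (hto i).mul_const (P.trans E θ i j)
  simpa [alive] using h

/-- If the sender stops on a set that can be reached from everywhere, then a function that is
harmonic wherever she may continue has the same expectation at the start and at the end. -/
theorem sum_endProb_mul_eq {θ : Nature} {D : Finset (Fin m)} (hD : CanReach (P.trans E θ) D)
    {σ : SenderStrategy m} (hσ : ∀ i ∈ D, P.endRate σ θ i = 1) {u : Fin m → ℝ}
    (hu : ∀ i ∉ D, u i = ∑ j, P.trans E θ i j * u j) :
    ∑ i, P.endProb E σ θ i * u i = ∑ i, P.g i * u i := by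
  refine tendsto_nhds_unique (P.tendsto_sum_endAt_mul E σ θ u) ?_
  have h1 : Tendsto (fun t => ∑ i, P.g i * u i - ∑ i, P.alive E σ θ t i * u i) atTop
      (𝓝 (∑ i, P.g i * u i - ∑ i : Fin m, 0 * u i)) :=
    tendsto_const_nhds.sub
      (tendsto_finsetSum Finset.univ fun i _ => (tendsto_alive hD hσ i).mul_const (u i))
  simp only [zero_mul, Finset.sum_const_zero, sub_zero] at h1
  refine h1.congr fun t => ?_
  rw [← P.sum_alive_drift E σ θ u t]
  refine Finset.sum_congr rfl fun r _ => Finset.sum_congr rfl fun i _ => ?_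
  rw [endAt, mul_assoc]
  by_cases hi : i ∈ D
  · simp [hσ i hi]
  · rw [← hu i hi]; ring

theorem sum_endProb_eq_one {θ : Nature} {D : Finset (Fin m)} (hD : CanReach (P.trans E θ) D)
    {σ : SenderStrategy m} (hσ : ∀ i ∈ D, P.endRate σ θ i = 1) :
    ∑ i, P.endProb E σ θ i = 1 := by
  have h := sum_endProb_mul_eq hD hσ (u := fun _ => 1) (by simp [P.trans_sum E θ])
  have hg : ∑ i, P.g i = 1 := P.g.2.2
  simpa [hg] using h

/-- A state outside an absorbing set that can be reached from everywhere is transient. -/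
theorem isTransient_of_canReach {θ : Nature} {D : Finset (Fin m)}
    (hD : CanReach (P.trans E θ) D) (habs : ∀ i ∈ D, P.IsAbsorbing i) {j : Fin m} (hj : j ∉ D) :
    P.IsTransient E θ j := by
  have h0 := P.trans_nonneg E θ
  obtain ⟨φ, hφ0, hφ⟩ := hD.exists_drift h0 (P.trans_sum E θ)
  have hle : ∀ i, ∑ j, P.trans E θ i j * φ j ≤ φ i := by
    intro i
    by_cases hi : i ∈ D
    · simp [(habs i hi).trans_eq]
    · exact (hφ i hi).le
  have hpos : 0 < φ j :=
    (Finset.sum_nonneg fun k _ => mul_nonneg (h0 j k) (hφ0 k)).trans_lt (hφ j hj)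
  -- Optional stopping of the excessive `φ` at the first visit to `j`; at `k = j` it bounds the
  -- return probability by a ratio below 1.
  have hhit : ∀ n k, P.hitWithin E θ j n k * φ j ≤ ∑ l, P.trans E θ k l * φ l := by
    intro n
    induction n with
    | zero =>
      intro k
      simpa [hitWithin] using Finset.sum_nonneg fun l _ => mul_nonneg (h0 k l) (hφ0 l)
    | succ n ih =>
      intro k
      rw [hitWithin, ← Finset.add_sum_erase _ _ (Finset.mem_univ j), add_mul, Finset.sum_mul]
      refine add_le_add le_rfl (Finset.sum_le_sum fun l _ => ?_)
      rw [mul_assoc]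
      exact mul_le_mul_of_nonneg_left ((ih l).trans (hle l)) (h0 k l)
  have hret : P.returnProb E θ j ≤ (∑ l, P.trans E θ j l * φ l) / φ j :=
    ciSup_le fun n => (le_div_iff₀ hpos).2 (hhit n j)
  exact hret.trans_lt ((div_lt_one hpos).2 (hφ j hj))

end Protocol

/-! ### The sender's stopping problem and her best responses -/

namespace Protocol

variable {S : Type*} [Fintype S] {m : ℕ} {E : Environment S} {P : Protocol m S}

/-- The characterization used here of the value function `v` of the sender's stopping problem
in the state of nature `θ`. -/
structure IsValue (E : Environment S) (P : Protocol m S) (θ : Nature) (v : Fin m → ℝ) : Prop where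
  majorant : ∀ i, (P.a i : ℝ) ≤ v i
  excessive : ∀ i, ∑ j, P.trans E θ i j * v j ≤ v i
  absorbing : ∀ i, P.IsAbsorbing i → v i = P.a i
  harmonic : ∀ i, v i ≠ P.a i → v i = ∑ j, P.trans E θ i j * v j
  reach : CanReach (P.trans E θ) {i | v i = P.a i}

/-- The minimality condition on singletons gives the absorbing and harmonic clauses, and on larger
sets gives reachability. The latter rules out spurious solutions, such as a constant above the
reward on a closed class. -/
theorem exists_isValue (E : Environment S) (P : Protocol m S) (θ : Nature) :
    ∃ v, P.IsValue E θ v := by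
  obtain ⟨v, hva, hvT, hmin⟩ := exists_minimal_excessive (P.trans E θ) (P.trans_nonneg E θ)
    (P.trans_sum E θ) (fun i => (P.a i : ℝ)) (fun i => (P.a i).2.1) (fun i => (P.a i).2.2)
  refine ⟨v, hva, hvT, fun i hi => ?_, fun i hi => ?_, fun K hK hKD => ?_⟩
  · obtain ⟨k, hk, h⟩ := hmin {i} (Finset.singleton_nonempty i)
    rw [Finset.mem_singleton] at hk
    subst hk
    rcases h with h | ⟨-, j, hj, hpos⟩
    · exact h
    · rw [hi.trans_eq, if_neg (by simpa using hj)] at hpos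
      exact absurd hpos (lt_irrefl 0)
  · obtain ⟨k, hk, h⟩ := hmin {i} (Finset.singleton_nonempty i)
    rw [Finset.mem_singleton] at hk
    subst hk
    exact (h.resolve_left hi).1
  · obtain ⟨i, hi, h⟩ := hmin K hK
    refine ⟨i, hi, (h.resolve_left fun h => ?_).2⟩
    exact Finset.disjoint_left.1 hKD hi (by simpa using h)

theorem IsValue.nonneg {θ : Nature} {v : Fin m → ℝ} (hv : P.IsValue E θ v) (i : Fin m) :
    0 ≤ v i :=
  (P.a i).2.1.trans (hv.majorant i)

theorem IsValue.probH_le {θ : Nature} {v : Fin m → ℝ} (hv : P.IsValue E θ v)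
    (σ : SenderStrategy m) : P.probH E σ θ ≤ ∑ i, P.g i * v i :=
  (Finset.sum_le_sum fun i _ => mul_le_mul_of_nonneg_left (hv.majorant i)
    (P.endProb_nonneg E σ θ i)).trans (sum_endProb_mul_le hv.nonneg hv.excessive σ)

open Classical in
/-- The strategy of stopping exactly where `v` equals the sender's reward, with `v` depending on
the state of nature. -/
noncomputable def stopWhereEq (P : Protocol m S) (v : Nature → Fin m → ℝ) : SenderStrategy m :=
  fun i θ => if v θ i = P.a i then 1 else 0

open Classical in
set_option linter.unusedSectionVars false in
theorem endRate_stopWhereEq {v : Nature → Fin m → ℝ}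
    (hv : ∀ θ i, P.IsAbsorbing i → v θ i = P.a i) (θ : Nature) (i : Fin m) :
    P.endRate (P.stopWhereEq v) θ i = if v θ i = P.a i then 1 else 0 := by
  unfold endRate stopWhereEq
  split_ifs with h1 h2 h2
  · rfl
  · exact absurd (hv θ i h1) h2
  · rfl
  · rfl

theorem endProb_eq_zero {σ : SenderStrategy m} {θ : Nature} {i : Fin m}
    (h : P.endRate σ θ i = 0) : P.endProb E σ θ i = 0 := by
  simp [endProb, endAt, h]

/-- Only `v θ` for the given `θ` has to be a value: this allows the rule that is optimal in one
state of nature to be used in both. -/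
theorem probH_stopWhereEq {v : Nature → Fin m → ℝ}
    (habs : ∀ θ i, P.IsAbsorbing i → v θ i = P.a i) {θ : Nature} (hv : P.IsValue E θ (v θ)) :
    P.probH E (P.stopWhereEq v) θ = ∑ i, P.g i * v θ i := by
  rw [← sum_endProb_mul_eq hv.reach (σ := P.stopWhereEq v) (u := v θ), probH]
  · refine Finset.sum_congr rfl fun i _ => ?_
    by_cases hi : v θ i = P.a i
    · rw [hi]
    · rw [endProb_eq_zero (by rw [endRate_stopWhereEq habs, if_neg hi]), zero_mul, zero_mul]
  · intro i hi
    rw [endRate_stopWhereEq habs, if_pos (by simpa using hi)]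
  · intro i hi
    exact hv.harmonic i (by simpa using hi)

theorem stopWhereEq_mem_bestResponses {v : Nature → Fin m → ℝ}
    (hv : ∀ θ, P.IsValue E θ (v θ)) : P.stopWhereEq v ∈ P.bestResponses E := by
  intro τ
  have h : ∀ θ, P.probH E τ θ ≤ P.probH E (P.stopWhereEq v) θ := fun θ => by
    rw [probH_stopWhereEq (fun θ => (hv θ).absorbing) (hv θ)]
    exact (hv θ).probH_le τ
  exact add_le_add (mul_le_mul_of_nonneg_left (h _) E.p_pos.le)
    (mul_le_mul_of_nonneg_left (h _) (sub_nonneg.2 E.p_lt_one.le))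

theorem bestResponses_nonempty (E : Environment S) (P : Protocol m S) :
    (P.bestResponses E).Nonempty := by
  choose v hv using exists_isValue E P
  exact ⟨_, stopWhereEq_mem_bestResponses hv⟩

/-- A best response attains the value in each state of nature. -/
theorem probH_of_mem_bestResponses {v : Nature → Fin m → ℝ} (hv : ∀ θ, P.IsValue E θ (v θ))
    {σ : SenderStrategy m} (hσ : σ ∈ P.bestResponses E) (θ : Nature) :
    P.probH E σ θ = ∑ i, P.g i * v θ i := by
  have h := hσ (P.stopWhereEq v)
  have hb : ∀ θ, P.probH E (P.stopWhereEq v) θ = ∑ i, P.g i * v θ i := fun θ =>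
    probH_stopWhereEq (fun θ => (hv θ).absorbing) (hv θ)
  unfold senderPayoff at h
  rw [hb, hb] at h
  have hH := (hv Nature.H).probH_le σ
  have hL := (hv Nature.L).probH_le σ
  have hp := E.p_pos
  have hq := sub_pos.2 E.p_lt_one
  cases θ
  · refine le_antisymm hH (le_of_mul_le_mul_left ?_ hp)
    linarith [mul_le_mul_of_nonneg_left hL hq.le]
  · refine le_antisymm hL (le_of_mul_le_mul_left ?_ hq)
    linarith [mul_le_mul_of_nonneg_left hH hp.le]

/-! ### Construction of parsimonious protocols -/

/-- The point mass at the memory state `i`. -/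
noncomputable def pointMass (i : Fin m) : stdSimplex ℝ (Fin m) :=
  ⟨Pi.single i 1, single_mem_stdSimplex ℝ i⟩

theorem pointMass_apply (i j : Fin m) : pointMass i j = if j = i then 1 else 0 :=
  Pi.single_apply i 1 j

/-- The protocol that follows `P` outside `D`, moves from `A` to `iH` and from `D \ A` to `iL`,
and plays `H` in the memory state `iH` only. -/
noncomputable def redirect (P : Protocol m S) (D A : Finset (Fin m)) (iH iL : Fin m)
    (g : stdSimplex ℝ (Fin m)) : Protocol m S where
  f i s := if i ∈ A then pointMass iH else if i ∈ D then pointMass iL else P.f i s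
  g := g
  a i := if i = iH then 1 else 0

/-- Here `w θ i` is the sender's value in the redirected protocol. It solves the Dirichlet problem
for the original kernel with boundary data the indicator of `A` on `D`, which makes it comparable
with stopping on `D` in `P`. -/
theorem exists_parsimonious (P : Protocol m S) {D A : Finset (Fin m)} (hAD : A ⊆ D)
    {iH iL : Fin m} (hiH : iH ∈ A) (hiL : iL ∈ D) (hiLA : iL ∉ A)
    (hD : ∀ θ, CanReach (P.trans E θ) D) (g : stdSimplex ℝ (Fin m)) :
    ∃ P' : Protocol m S, P'.IsParsimonious E ∧ ∃ w : Nature → Fin m → ℝ,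
      (∀ θ, ∀ i ∈ A, w θ i = 1) ∧ (∀ θ, ∀ i ∈ D, i ∉ A → w θ i = 0) ∧
      (∀ θ, ∀ i ∉ D, w θ i = ∑ j, P.trans E θ i j * w θ j) ∧
      ∀ σ ∈ P'.bestResponses E, P'.receiverPayoff E σ =
        E.p * ∑ i, g i * w Nature.H i + (1 - E.p) * (1 - ∑ i, g i * w Nature.L i) := by
  set Q := P.redirect D A iH iL g with hQ
  have hfA : ∀ i ∈ A, ∀ s, Q.f i s = pointMass iH := fun i hi s => if_pos hi
  have hfD : ∀ i ∈ D, i ∉ A → ∀ s, Q.f i s = pointMass iL := fun i hi hiA s =>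
    (if_neg hiA).trans (if_pos hi)
  have hf : ∀ i ∉ D, ∀ s, Q.f i s = P.f i s := fun i hi s =>
    (if_neg fun h => hi (hAD h)).trans (if_neg hi)
  have htA : ∀ θ, ∀ i ∈ A, ∀ j, Q.trans E θ i j = if j = iH then 1 else 0 := by
    intro θ i hi j
    simp only [trans, hfA i hi, pointMass_apply, ← Finset.sum_mul, E.signal_sum, one_mul]
  have htD : ∀ θ, ∀ i ∈ D, i ∉ A → ∀ j, Q.trans E θ i j = if j = iL then 1 else 0 := by
    intro θ i hi hiA j
    simp only [trans, hfD i hi hiA, pointMass_apply, ← Finset.sum_mul, E.signal_sum, one_mul]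
  have ht : ∀ θ, ∀ i ∉ D, ∀ j, Q.trans E θ i j = P.trans E θ i j := by
    intro θ i hi j
    simp only [trans, hf i hi]
  have habsH : Q.IsAbsorbing iH := fun s => by rw [hfA iH hiH, pointMass_apply, if_pos rfl]
  have habsL : Q.IsAbsorbing iL := fun s => by rw [hfD iL hiL hiLA, pointMass_apply, if_pos rfl]
  have hne : iL ≠ iH := fun h => hiLA (h ▸ hiH)
  have haH : (Q.a iH : ℝ) = 1 := by simp [hQ, redirect]
  have ha : ∀ i, i ≠ iH → (Q.a i : ℝ) = 0 := fun i hi => by simp [hQ, redirect, hi]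
  have habs : ∀ i ∈ ({iL, iH} : Finset (Fin m)), Q.IsAbsorbing i := by
    intro i hi
    rw [Finset.mem_insert, Finset.mem_singleton] at hi
    rcases hi with rfl | rfl
    exacts [habsL, habsH]
  have hreach : ∀ θ, CanReach (Q.trans E θ) {iL, iH} := by
    intro θ K hK hKd
    have hHK : iH ∉ K := fun h => Finset.disjoint_left.1 hKd h (by simp)
    have hLK : iL ∉ K := fun h => Finset.disjoint_left.1 hKd h (by simp)
    by_cases hKD : Disjoint K D
    · obtain ⟨i, hi, j, hj, hij⟩ := hD θ K hK hKD
      exact ⟨i, hi, j, hj, by rwa [ht θ i (Finset.disjoint_left.1 hKD hi)]⟩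
    · obtain ⟨i, hi, hiD⟩ := Finset.not_disjoint_iff.1 hKD
      by_cases hiA : i ∈ A
      · exact ⟨i, hi, iH, hHK, by rw [htA θ i hiA, if_pos rfl]; exact one_pos⟩
      · exact ⟨i, hi, iL, hLK, by rw [htD θ i hiD hiA, if_pos rfl]; exact one_pos⟩
  choose w hw using exists_isValue E Q
  have hwH : ∀ θ, w θ iH = 1 := fun θ => ((hw θ).absorbing iH habsH).trans haH
  have hwL : ∀ θ, w θ iL = 0 := fun θ => ((hw θ).absorbing iL habsL).trans (ha iL hne)
  have hharm : ∀ θ i, i ≠ iH → w θ i = ∑ j, Q.trans E θ i j * w θ j := by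
    intro θ i hi
    -- Away from `iH` stopping pays 0, so a state where `w` equals the reward has `w = 0`;
    -- excessivity and nonnegativity then force harmonicity there too.
    by_cases h : w θ i = Q.a i
    · refine le_antisymm ?_ ((hw θ).excessive i)
      rw [h, ha i hi]
      exact Finset.sum_nonneg fun j _ => mul_nonneg (Q.trans_nonneg E θ i j) ((hw θ).nonneg j)
    · exact (hw θ).harmonic i h
  refine ⟨Q, ⟨iL, iH, hne, habsL, ha iL hne, habsH, haH, fun j hjL hjH =>
      ⟨fun θ => isTransient_of_canReach (hreach θ) habs (by simp [hjL, hjH]), ha j hjH⟩⟩,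
    w, ?_, ?_, ?_, ?_⟩
  · intro θ i hi
    rcases eq_or_ne i iH with rfl | h
    · exact hwH θ
    · rw [hharm θ i h]
      simp [htA θ i hi, hwH]
  · intro θ i hi hiA
    rw [hharm θ i fun h => hiA (h ▸ hiH)]
    simp [htD θ i hi hiA, hwL]
  · intro θ i hi
    rw [hharm θ i fun h => hi (h ▸ hAD hiH)]
    simp only [ht θ i hi]
  · intro σ hσ
    have hH := probH_of_mem_bestResponses hw hσ Nature.H
    have hL := probH_of_mem_bestResponses hw hσ Nature.L
    have hsum := probH_add_probL (E := E) (P := Q) Nature.L σ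
    -- Whatever the sender does, the game ends almost surely, so the probability of `L` is the
    -- complement of that of `H`.
    rw [sum_endProb_eq_one (hreach Nature.L) (σ := σ)
      fun i hi => by rw [endRate, if_pos (habs i hi)]] at hsum
    rw [receiverPayoff, hH, eq_sub_of_add_eq' hsum, hL]
    rfl

end Protocol

/-! ### Domination by a parsimonious protocol -/

namespace Protocol

variable {S : Type*} [Fintype S] {m : ℕ} {E : Environment S}

/-- Starting a parsimonious protocol in an absorbing memory state. -/
theorem exists_parsimonious_const (P : Protocol m S) (hm : 2 ≤ m) :
    (∃ P' : Protocol m S, P'.IsParsimonious E ∧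
      ∀ σ ∈ P'.bestResponses E, P'.receiverPayoff E σ = E.p) ∧
    ∃ P' : Protocol m S, P'.IsParsimonious E ∧
      ∀ σ ∈ P'.bestResponses E, P'.receiverPayoff E σ = 1 - E.p := by
  let iH : Fin m := ⟨0, by omega⟩
  let iL : Fin m := ⟨1, by omega⟩
  have hne : iL ≠ iH := by simp [iL, iH]
  have hreach : ∀ θ, CanReach (P.trans E θ) Finset.univ := fun θ K ⟨i, hi⟩ hKd =>
    absurd (Finset.mem_univ i) (Finset.disjoint_left.1 hKd hi)
  have key := fun g => exists_parsimonious P (Finset.subset_univ {iH})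
    (Finset.mem_singleton_self iH) (Finset.mem_univ iL) (by simpa using hne) hreach g
  constructor
  · obtain ⟨P', hP', w, hwA, -, -, hU⟩ := key (pointMass iH)
    refine ⟨P', hP', fun σ hσ => ?_⟩
    rw [hU σ hσ]
    simp [pointMass_apply, hwA]
  · obtain ⟨P', hP', w, -, hwD, -, hU⟩ := key (pointMass iL)
    refine ⟨P', hP', fun σ hσ => ?_⟩
    rw [hU σ hσ]
    simp [pointMass_apply, hwD _ iL (Finset.mem_univ iL) (by simpa using hne)]

theorem exists_parsimonious_ge (P : Protocol m S) (hm : 2 ≤ m) :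
    ∃ P' : Protocol m S, P'.IsParsimonious E ∧
      ∀ σ ∈ P.bestResponses E, ∀ σ' ∈ P'.bestResponses E,
        P.receiverPayoff E σ ≤ P'.receiverPayoff E σ' := by
  classical
  have hp := E.p_pos
  have hq := sub_pos.2 E.p_lt_one
  choose v hv using exists_isValue E P
  set vH := v Nature.H with hvH
  have habs : ∀ θ : Nature, ∀ i, P.IsAbsorbing i → vH i = P.a i :=
    fun _ => (hv Nature.H).absorbing
  let D : Finset (Fin m) := {i | vH i = P.a i}
  -- In both states of nature, stop where it is optimal to do so in the state `H`.
  set τ : SenderStrategy m := P.stopWhereEq fun _ => vH with hτ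
  set q : Nature → Fin m → ℝ := P.endProb E τ with hqd
  have hτD : ∀ θ, ∀ i ∈ D, P.endRate τ θ i = 1 := fun θ i hi => by
    rw [hτ, endRate_stopWhereEq habs, if_pos (by simpa [D] using hi)]
  have hreach : ∀ θ, CanReach (P.trans E θ) D := fun θ =>
    canReach_trans Nature.H θ (hv Nature.H).reach
  have hq0 : ∀ θ i, 0 ≤ q θ i := P.endProb_nonneg E τ
  have hqD : ∀ θ, ∀ i ∉ D, q θ i = 0 := fun θ i hi =>
    endProb_eq_zero (by rw [hτ, endRate_stopWhereEq habs, if_neg (by simpa [D] using hi)])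
  have hq1 : ∀ θ, ∑ i, q θ i = 1 := fun θ => sum_endProb_eq_one (hreach θ) (hτD θ)
  -- The receiver's net gain from action `H` over `L` when `τ` ends the game in `i`.
  let c : Fin m → ℝ := fun i => E.p * q Nature.H i - (1 - E.p) * q Nature.L i
  let A : Finset (Fin m) := {i | 0 < c i}
  have hcD : ∀ i ∉ D, c i = 0 := fun i hi => by simp [c, hqD _ i hi]
  have hAD : A ⊆ D := fun i hi => by
    by_contra h
    simp [A, hcD i h] at hi
  have hU : ∀ σ ∈ P.bestResponses E, P.receiverPayoff E σ ≤ (1 - E.p) + ∑ i ∈ A, c i := by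
    intro σ hσ
    have h1 : P.probH E σ Nature.H = P.probH E τ Nature.H := by
      rw [probH_of_mem_bestResponses hv hσ, hτ, probH_stopWhereEq habs (hv Nature.H)]
    -- In state `L` the sender could imitate her behaviour in state `H`.
    have h2 : P.probH E τ Nature.L ≤ P.probH E σ Nature.L := by
      rw [probH_of_mem_bestResponses hv hσ]
      exact (hv Nature.L).probH_le τ
    have h3 : P.probL E σ Nature.L ≤ 1 - P.probH E τ Nature.L := by
      linarith [probH_add_probL (E := E) (P := P) Nature.L σ,
        sum_endProb_le_one (E := E) (P := P) Nature.L σ]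
    have h4 : E.p * P.probH E τ Nature.H - (1 - E.p) * P.probH E τ Nature.L
        = ∑ i, c i * P.a i := by
      simp only [probH, Finset.mul_sum, ← Finset.sum_sub_distrib]
      exact Finset.sum_congr rfl fun i _ => by simp only [c, hqd]; ring
    have h5 : ∑ i, c i * P.a i ≤ ∑ i ∈ A, c i := by
      rw [Finset.sum_filter]
      refine Finset.sum_le_sum fun i _ => ?_
      split_ifs with h
      · exact mul_le_of_le_one_right h.le (P.a i).2.2
      · exact mul_nonpos_of_nonpos_of_nonneg (not_lt.1 h) (P.a i).2.1
    rw [receiverPayoff, h1]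
    linarith [mul_le_mul_of_nonneg_left h3 hq.le]
  obtain ⟨⟨PH, hPH, hUH⟩, PL, hPL, hUL⟩ := exists_parsimonious_const (E := E) P hm
  rcases A.eq_empty_or_nonempty with hA | ⟨iH, hiH⟩
  · refine ⟨PL, hPL, fun σ hσ σ' hσ' => ?_⟩
    rw [hUL σ' hσ']
    simpa [hA] using hU σ hσ
  by_cases hDA : ∃ iL ∈ D, iL ∉ A
  · obtain ⟨iL, hiL, hiLA⟩ := hDA
    obtain ⟨P', hP', w, hwA, hwD, hw, hU'⟩ :=
      exists_parsimonious P hAD hiH hiL hiLA hreach P.g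
    refine ⟨P', hP', fun σ hσ σ' hσ' => (hU σ hσ).trans_eq ?_⟩
    -- Since `w` is harmonic outside `D`, its initial expectation equals its expectation when `τ`
    -- stops, which is the probability of stopping in `A`.
    have hsum : ∀ θ, ∑ i ∈ A, q θ i = ∑ i, P.g i * w θ i := by
      intro θ
      rw [← sum_endProb_mul_eq (hreach θ) (hτD θ) (hw θ),
        ← Finset.sum_subset (Finset.subset_univ A)]
      · exact Finset.sum_congr rfl fun i hi => by rw [hwA θ i hi, mul_one]
      · intro i _ hi
        by_cases hiD : i ∈ D
        · rw [hwD θ i hiD hi, mul_zero]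
        · exact mul_eq_zero_of_left (hqD θ i hiD) _
    rw [hU' σ' hσ', ← hsum, ← hsum]
    simp only [c, Finset.sum_sub_distrib, ← Finset.mul_sum]
    ring
  -- Now `A` is all of `D`, so `H` is the better action wherever `τ` stops and the bound is the
  -- payoff from always playing `H`.
  · push Not at hDA
    refine ⟨PH, hPH, fun σ hσ σ' hσ' => (hU σ hσ).trans_eq ?_⟩
    have hsum : ∀ θ, ∑ i ∈ A, q θ i = 1 := fun θ => by
      rw [← hq1 θ]
      exact Finset.sum_subset (Finset.subset_univ A) fun i _ hi =>
        hqD θ i fun h => hi (hDA i h)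
    rw [hUH σ' hσ']
    simp only [c, Finset.sum_sub_distrib, ← Finset.mul_sum, hsum]
    ring

end Protocol

/-- Every non-parsimonious protocol with `m ≥ 2` memory states is weakly dominated, for the
receiver, by a parsimonious protocol with at most `m` memory states. The receiver's payoff from a
protocol is his payoff when the sender plays a best response; best responses exist, and the
comparison holds whichever of them is played. -/
theorem mainTheorem1 {S : Type*} [Fintype S] (E : Environment S) (m : ℕ) (hm : 2 ≤ m)
    (P : Protocol m S) (hP : ¬ P.IsParsimonious E) :
    ∃ (m' : ℕ) (_ : m' ≤ m) (P' : Protocol m' S),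
      P'.IsParsimonious E ∧
      (P.bestResponses E).Nonempty ∧ (P'.bestResponses E).Nonempty ∧
      ∀ σ ∈ P.bestResponses E, ∀ σ' ∈ P'.bestResponses E,
        P.receiverPayoff E σ ≤ P'.receiverPayoff E σ' := by
  obtain ⟨P', hP', h⟩ := P.exists_parsimonious_ge (E := E) hm
  exact ⟨m, le_rfl, P', hP', P.bestResponses_nonempty E, P'.bestResponses_nonempty E, h⟩
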